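/- Let $F$ be a field and let $R$ be an associative unital $F$-algebra with unit group $U(R)$. An infinite subgroup $H$ of $U(R)$ is called an $\omega$-subgroup if, for all $x,y\in R$ with $xy-yx\neq 0$, the left annihilator of $xy-yx$ in $R$ contains only finitely many elements of the form $1-h$ with $h\in H$. Let $$\nabla(R)=\{a\in R \mid [U(R):C_{U(R)}(a)]<\infty\},$$ where $C_{U(R)}(a)$ is the group of units commuting with $a$; this is an $F$-subalgebra of $R$, the FC-subalgebra. Theorem 1. Suppose that $U(R)$ contains an $\omega$-subgroup. Then the set $A$ of all elements of $\nabla(R)$ that are algebraic over $F$ is a subalgebra of $\nabla(R)$, and it is locally finite, i.e. every finite subset of $A$ generates a finite-dimensional subalgebra. The Jacobson radical $J(A)$ is a two-sided ideal of $\nabla(R)$, it is contained in the center of $\nabla(R)$, and it is locally nilpotent, i.e. every finite subset of $J(A)$ generates a nilpotent (non-unital) subalgebra. Finally, the quotient $A/J(A)$ is commutative. -/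

import Mathlib

/-- The centralizer `C_{U(R)}(a)` of an element `a` of a ring `R` in the unit group of `R`. -/
def unitCentralizer {R : Type*} [Ring R] (a : R) : Subgroup Rˣ where
  carrier := {u | (u : R) * a = a * u}
  one_mem' := by simp
  mul_mem' := by
    intro u v hu hv
    simp only [Set.mem_ofPred_eq, Units.val_mul] at *
    rw [mul_assoc, hv, ← mul_assoc, hu, mul_assoc]
  inv_mem' := by
    intro u hu
    exact ((show Commute (u : R) a from hu).units_inv_left).eq

/-- An element is an FC-element if its centralizer in the unit group has finite index there. -/
def IsFCElement {R : Type*} [Ring R] (a : R) : Prop :=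
  (unitCentralizer a).FiniteIndex

theorem IsFCElement.of_le {R : Type*} [Ring R] {a b c : R} (ha : IsFCElement a)
    (hb : IsFCElement b) (h : unitCentralizer a ⊓ unitCentralizer b ≤ unitCentralizer c) :
    IsFCElement c := by
  have : (unitCentralizer a).FiniteIndex := ha
  have : (unitCentralizer b).FiniteIndex := hb
  exact Subgroup.finiteIndex_of_le h

/-- The FC-subalgebra `∇(R)`: all elements of the algebra whose centralizer in the unit
group has finite index. -/
def FCSubalgebra (F : Type*) (R : Type*) [Field F] [Ring R] [Algebra F R] :
    Subalgebra F R where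
  carrier := {a | IsFCElement a}
  mul_mem' := by
    intro a b ha hb
    refine IsFCElement.of_le ha hb ?_
    rintro u ⟨h1, h2⟩
    exact (show Commute (u : R) a from h1).mul_right (show Commute (u : R) b from h2)
  add_mem' := by
    intro a b ha hb
    refine IsFCElement.of_le ha hb ?_
    rintro u ⟨h1, h2⟩
    exact (show Commute (u : R) a from h1).add_right (show Commute (u : R) b from h2)
  algebraMap_mem' := by
    intro r
    have h : unitCentralizer (algebraMap F R r) = ⊤ :=
      eq_top_iff.2 fun u _ => (Algebra.commutes r (u : R)).symm
    show (unitCentralizer (algebraMap F R r)).FiniteIndex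
    rw [h]
    infer_instance

/-- An infinite subgroup `H` of the unit group is an ω-subgroup if the left annihilator of each
nonzero Lie commutator `x * y - y * x` contains only finitely many elements `1 - h`, `h ∈ H`. -/
def IsOmegaSubgroup {R : Type*} [Ring R] (H : Subgroup Rˣ) : Prop :=
  (H : Set Rˣ).Infinite ∧
    ∀ x y : R, x * y - y * x ≠ 0 →
      {a : R | a * (x * y - y * x) = 0 ∧ ∃ h ∈ H, a = 1 - (h : R)}.Finite

/-- An algebra is locally finite if every finite subset generates a finite-dimensional
subalgebra. -/
def IsLocallyFiniteAlgebra (F : Type*) (S : Type*) [Field F] [Ring S] [Algebra F S] : Prop :=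
  ∀ s : Finset S, FiniteDimensional F (Algebra.adjoin F (s : Set S))

/-- A two-sided ideal of an algebra is locally nilpotent if each finite subset of it generates
a nilpotent (non-unital) subalgebra `N`, that is, `N ^ n = 0` for some `n`. -/
def IsLocallyNilpotentIdeal (F : Type*) {S : Type*} [Field F] [Ring S] [Algebra F S]
    (J : TwoSidedIdeal S) : Prop :=
  ∀ s : Finset S, (s : Set S) ⊆ (J : Set S) →
    IsNilpotent (NonUnitalAlgebra.adjoin F (s : Set S)).toSubmodule

/-!
The ω-subgroup `H` enters only through the fact that nilpotent elements of `∇(R)` are central in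
`∇(R)` (`commute_of_isNilpotent_of_isOmegaSubgroup`). If a nilpotent `x` and some `y` in `∇(R)` did
not commute, then by induction `x ^ 2` commutes with `y`; for the infinitely many `h ∈ H`
centralizing `x` and `y`, the units `1 + x * (1 - h)` meet only finitely many cosets of the
centralizer of `y`, and two units in one coset yield an element `1 - h⁻¹ * k` annihilating the
commutator of `x` and `y`. Infinitely many such elements contradict the definition of an
ω-subgroup.

The rest concerns an algebra `T` over `F` all of whose elements are FC-elements and whose nilpotent
elements are central. If `F` is infinite, all algebraic elements of `T` are central
(`commute_of_isAlgebraic_of_isFCElement`). If `F` is finite, idempotents of `T` are central, and an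
algebraic `x` has an idempotent power; this writes `x` as the sum of a unit of finite order and a
central algebraic element. Torsion FC-units generate finite groups (`finite_closure_of_isOfFinOrder`),
so finitely many algebraic elements generate a finite-dimensional algebra
(`finiteDimensional_adjoin_of_isAlgebraic`). In particular the algebraic elements form a subalgebra
`A`.

An algebraic element of the Jacobson radical is nilpotent, and central nilpotents belong to the
radical, so `J(A)` is the set of nilpotent elements of `T`, a central ideal. It is locally nilpotent
because finitely generated nil ideals of a commutative ring are nilpotent. Over a finite field two
algebraic elements generate a finite ring, which is commutative modulo its radical by the theorems
of Wedderburn–Artin and Wedderburn; hence commutators of algebraic elements are nilpotent and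
`A / J(A)` is commutative.
-/

/-! ### Nilpotent and algebraic FC-elements -/

/-- Pigeonhole for cosets: an infinite family in a group has an infinite subfamily inside a single
left coset of a given subgroup of finite index. -/
theorem exists_infinite_forall_inv_mul_mem {G ι : Type*} [Group G] [Infinite ι] (f : ι → G)
    (C : Subgroup G) [C.FiniteIndex] :
    ∃ t : Set ι, t.Infinite ∧ ∀ i ∈ t, ∀ j ∈ t, (f i)⁻¹ * f j ∈ C := by
  obtain ⟨c, hc⟩ := Finite.exists_infinite_fiber fun i => (f i : G ⧸ C)
  refine ⟨_, Set.infinite_coe_iff.1 hc, fun i hi j hj => QuotientGroup.eq.1 ?_⟩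
  exact (Set.mem_singleton_iff.1 hi).trans (Set.mem_singleton_iff.1 hj).symm

/-- The inductive step in showing that nilpotent FC-elements commute with all FC-elements. The
infinitely many `h ∈ H` centralizing `x` and `y` give units `1 + x * (1 - h)`, infinitely many of
which lie in one coset of the centralizer of `y`; comparing two of them shows that `1 - h⁻¹ * k`
annihilates `x * y - y * x`. -/
theorem commute_of_sq_commute_of_isOmegaSubgroup {R : Type*} [Ring R] {H : Subgroup Rˣ}
    (hH : IsOmegaSubgroup H) {x y : R} (hx : IsFCElement x) (hy : IsFCElement y)
    (hnil : IsNilpotent x) (hsq : Commute (x ^ 2) y) : Commute x y := by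
  by_contra hxy
  have hc : x * y - y * x ≠ 0 := fun h => hxy (sub_eq_zero.1 h)
  have : (unitCentralizer x).FiniteIndex := hx
  have : (unitCentralizer y).FiniteIndex := hy
  have : Infinite H := hH.1.to_subtype
  obtain ⟨t, ht, htC⟩ := exists_infinite_forall_inv_mul_mem (fun h : H => (h : Rˣ))
    (unitCentralizer x ⊓ unitCentralizer y)
  obtain ⟨h₀, hh₀⟩ := ht.nonempty
  -- the part of `H` centralizing both `x` and `y`
  let K : Set H := {k | (k : Rˣ) ∈ unitCentralizer x ⊓ unitCentralizer y}
  have hK : K.Infinite := by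
    refine (ht.image ((mul_right_injective h₀⁻¹).injOn)).mono ?_
    rintro _ ⟨h, hh, rfl⟩
    exact htC h₀ hh₀ h hh
  have : Infinite K := hK.to_subtype
  have hKx (k : K) : Commute ((k : Rˣ) : R) x := k.2.1
  have hKy (k : K) : Commute ((k : Rˣ) : R) y := k.2.2
  have hunit (k : K) : IsUnit (1 + x * (1 - ((k : Rˣ) : R))) :=
    (((Commute.one_right x).sub_right (hKx k).symm).isNilpotent_mul_right hnil).isUnit_one_add
  choose v hv using hunit
  obtain ⟨s, hs, hsC⟩ := exists_infinite_forall_inv_mul_mem v (unitCentralizer y)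
  obtain ⟨h, hh⟩ := hs.nonempty
  refine ((hs.image (f := fun k : K => (1 : R) - (((h : Rˣ)⁻¹ * (k : Rˣ) : Rˣ) : R)) ?_).mono ?_)
    (hH.2 x y hc)
  · intro k _ l _ hkl
    exact Subtype.ext (Subtype.ext (mul_left_cancel (Units.ext (sub_right_injective hkl))))
  · rintro _ ⟨k, hk, rfl⟩
    refine ⟨?_, _, H.mul_mem (H.inv_mem h.1.2) k.1.2, rfl⟩
    -- `(1 - x * (1 - h)) * (1 + x * (1 - h))` involves only `x ^ 2` and `h`, so it commutes
    -- with `y`, and no inverse of `1 + x * (1 - h)` has to be expanded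
    have key : Commute ((1 - x * (1 - ((h : Rˣ) : R))) * (1 + x * (1 - ((k : Rˣ) : R)))) y := by
      have e : (1 - x * (1 - ((h : Rˣ) : R))) * (1 + x * (1 - ((k : Rˣ) : R)))
          = (1 - x ^ 2 * (1 - ((h : Rˣ) : R)) ^ 2) * ((v h)⁻¹ * v k : Rˣ) := by
        have e1 : 1 - x ^ 2 * (1 - ((h : Rˣ) : R)) ^ 2
            = (1 - x * (1 - ((h : Rˣ) : R))) * v h := by
          have hc1 : Commute x (1 - ((h : Rˣ) : R)) :=
            (Commute.one_right x).sub_right (hKx h).symm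
          rw [hv, ← hc1.mul_pow]; noncomm_ring
        rw [e1, Units.val_mul, mul_assoc, Units.mul_inv_cancel_left, hv]
      rw [e]
      refine Commute.mul_left ?_ (hsC h hh k hk)
      exact (Commute.one_left y).sub_left
        (hsq.mul_left (((Commute.one_left y).sub_left (hKy h)).pow_left 2))
    have hk1 : Commute (1 - ((h : Rˣ) : R)) y := (Commute.one_left y).sub_left (hKy h)
    have hk2 : Commute (1 - ((k : Rˣ) : R)) y := (Commute.one_left y).sub_left (hKy k)
    have hk3 : Commute (1 - ((h : Rˣ) : R)) x := (Commute.one_left x).sub_left (hKx h)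
    -- modulo elements commuting with `y`, the product above is `x * (h - k)`
    have h1 : Commute (x * (((h : Rˣ) : R) - ((k : Rˣ) : R))) y := by
      have e : x * (((h : Rˣ) : R) - ((k : Rˣ) : R))
          = (1 - x * (1 - ((h : Rˣ) : R))) * (1 + x * (1 - ((k : Rˣ) : R))) - 1
            + x ^ 2 * ((1 - ((h : Rˣ) : R)) * (1 - ((k : Rˣ) : R))) := by
        have e2 : x * (1 - ((h : Rˣ) : R)) * (x * (1 - ((k : Rˣ) : R)))
          = x ^ 2 * ((1 - ((h : Rˣ) : R)) * (1 - ((k : Rˣ) : R))) := by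
          rw [mul_assoc, ← mul_assoc _ x, hk3.eq, mul_assoc, ← mul_assoc, sq]
        rw [← e2]; noncomm_ring
      rw [e]
      exact (key.sub_left (Commute.one_left y)).add_left (hsq.mul_left (hk1.mul_left hk2))
    have h2 : Commute (((h : Rˣ) : R) - ((k : Rˣ) : R)) y := (hKy h).sub_left (hKy k)
    have h3 : Commute (((h : Rˣ) : R) - ((k : Rˣ) : R)) x := (hKx h).sub_left (hKx k)
    have h4 : (((h : Rˣ) : R) - ((k : Rˣ) : R)) * (x * y - y * x) = 0 := by
      rw [mul_sub, ← mul_assoc, ← mul_assoc, h3.eq, h1.eq, h2.eq, mul_assoc y, h3.eq, sub_self]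
    have h5 : (1 : R) - (((h : Rˣ)⁻¹ * (k : Rˣ) : Rˣ) : R)
        = (((h : Rˣ)⁻¹ : Rˣ) : R) * (((h : Rˣ) : R) - ((k : Rˣ) : R)) := by
      rw [mul_sub, Units.inv_mul, Units.val_mul]
    beta_reduce
    rw [h5, mul_assoc, h4, mul_zero]

theorem IsFCElement.pow {R : Type*} [Ring R] {x : R} (hx : IsFCElement x) (n : ℕ) :
    IsFCElement (x ^ n) :=
  hx.of_le hx fun _ h => Commute.pow_right h.1 n

/-- Nilpotent FC-elements commute with all FC-elements if there is an ω-subgroup. If `x ^ n = 0`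
with `n ≥ 2`, then `(x ^ 2) ^ (n - 1) = 0`, so that induction on `n` applies to `x ^ 2`. -/
theorem commute_of_isNilpotent_of_isOmegaSubgroup {R : Type*} [Ring R] {H : Subgroup Rˣ}
    (hH : IsOmegaSubgroup H) {x y : R} (hx : IsFCElement x) (hy : IsFCElement y)
    (hnil : IsNilpotent x) : Commute x y := by
  obtain ⟨n, hn⟩ := hnil
  induction n generalizing x with
  | zero => exact (eq_zero_of_zero_eq_one (by simpa using hn.symm) x) ▸ Commute.zero_left y
  | succ n ih =>
    rcases n with _ | n
    · rw [zero_add, pow_one] at hn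
      exact hn ▸ Commute.zero_left y
    · refine commute_of_sq_commute_of_isOmegaSubgroup hH hx hy ⟨_, hn⟩ (ih (hx.pow 2) ?_)
      rw [← pow_mul]
      exact pow_eq_zero_of_le (by omega) hn

/-- Over an infinite field, an FC-element `y` commutes with every algebraic `x`: infinitely many
`a - x` with `a` a scalar are units, two of them lie in one coset of the centralizer of `y`, and
their quotient determines `x`. -/
theorem commute_of_isAlgebraic_of_isFCElement {F T : Type*} [Field F] [Infinite F] [Ring T]
    [Algebra F T] {x y : T} (hx : IsAlgebraic F x) (hy : IsFCElement y) : Commute x y := by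
  obtain ⟨p, hp0, hp⟩ := hx
  have hroots : {c : F | p.eval c ≠ 0}.Infinite := by
    have := (Polynomial.rootSet_finite p F).infinite_compl
    refine this.mono fun c hc => ?_
    simpa [Polynomial.mem_rootSet, hp0] using hc
  have hunit (c : {c : F | p.eval c ≠ 0}) : IsUnit (algebraMap F T c - x) := by
    by_contra h
    have h1 := spectrum.subset_polynomial_aeval x p ⟨c, h, rfl⟩
    rw [hp] at h1
    refine h1 ?_
    rw [spectrum.mem_resolventSet_iff, sub_zero]
    exact (IsUnit.mk0 _ c.2).map (algebraMap F T)
  choose v hv using hunit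
  have : Infinite {c : F | p.eval c ≠ 0} := hroots.to_subtype
  have : (unitCentralizer y).FiniteIndex := hy
  obtain ⟨t, ht, htC⟩ := exists_infinite_forall_inv_mul_mem v (unitCentralizer y)
  obtain ⟨a, ha, b, hb, hab⟩ := ht.nontrivial
  -- `(a - x)⁻¹ * (b - x) = 1 + (b - a) * (a - x)⁻¹` commutes with `y`
  have h1 : Commute ((((v a)⁻¹ : Tˣ) : T) * v b) y := htC a ha b hb
  have h2 : (((v a)⁻¹ : Tˣ) : T) * v b = 1 + (b - a : F) • (((v a)⁻¹ : Tˣ) : T) := by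
    have : (v b : T) = v a + algebraMap F T (b - a) := by rw [hv, hv, map_sub]; abel
    rw [this, mul_add, Units.inv_mul, Algebra.smul_def, Algebra.commutes]
  have hne : (b - a : F) ≠ 0 := sub_ne_zero.2 fun h => hab (Subtype.ext h.symm)
  have h3 : Commute (((v a)⁻¹ : Tˣ) : T) y := by
    have h4 : (((v a)⁻¹ : Tˣ) : T) = (b - a : F)⁻¹ • ((((v a)⁻¹ : Tˣ) : T) * v b - 1) := by
      rw [h2, add_sub_cancel_left, smul_smul, inv_mul_cancel₀ hne, one_smul]
    rw [h4]
    exact (h1.sub_left (Commute.one_left y)).smul_left _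
  have h4 : Commute (v a : T) y := by simpa using h3.units_inv_left
  have h5 : x = algebraMap F T a - v a := by rw [hv]; abel
  rw [h5]
  exact Commute.sub_left (Algebra.commutes a.1 y) h4

/-! ### Finiteness of groups generated by torsion FC-elements -/

open scoped commutatorElement in
theorem finite_commutatorSet_of_finiteIndex_center {G : Type*} [Group G]
    [(Subgroup.center G).FiniteIndex] : Finite (commutatorSet G) := by
  refine Set.Finite.subset (Set.finite_range fun p : (G ⧸ Subgroup.center G) × (G ⧸ Subgroup.center G) =>
    ⁅p.1.out, p.2.out⁆) ?_
  rintro _ ⟨g, h, rfl⟩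
  refine ⟨(g, h), ?_⟩
  obtain ⟨⟨z, hz⟩, hg⟩ := QuotientGroup.mk_out_eq_mul (Subgroup.center G) g
  obtain ⟨⟨w, hw⟩, hh⟩ := QuotientGroup.mk_out_eq_mul (Subgroup.center G) h
  have hz' := Subgroup.mem_center_iff.1 hz
  have hw' := Subgroup.mem_center_iff.1 hw
  simp only at hg hh ⊢
  rw [hg, hh, commutatorElement_def, commutatorElement_def, mul_inv_rev, mul_inv_rev]
  calc g * z * (h * w) * (z⁻¹ * g⁻¹) * (w⁻¹ * h⁻¹)
      = g * (z * (h * w)) * z⁻¹ * g⁻¹ * w⁻¹ * h⁻¹ := by group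
    _ = g * h * (w * g⁻¹) * w⁻¹ * h⁻¹ := by rw [← hz' (h * w)]; group
    _ = g * h * g⁻¹ * h⁻¹ := by rw [← hw' g⁻¹]; group

/-- The center has finite index, so the commutator subgroup is finite by Schur's theorem, while the
abelianization is a finitely generated abelian torsion group. -/
theorem finite_of_closure_eq_top_of_isOfFinOrder {G : Type*} [Group G] {s : Set G}
    (hs : s.Finite) (hcl : Subgroup.closure s = ⊤) (hord : ∀ u ∈ s, IsOfFinOrder u)
    (hfc : ∀ u ∈ s, (Subgroup.centralizer {u}).FiniteIndex) : Finite G := by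
  have : Group.FG G := Group.fg_iff.2 ⟨s, hcl, hs⟩
  have : Finite s := hs
  have hcenter : (⨅ u : s, Subgroup.centralizer {(u : G)}).FiniteIndex :=
    Subgroup.finiteIndex_iInf fun u => hfc u u.2
  have : (Subgroup.center G).FiniteIndex := by
    refine Subgroup.finiteIndex_of_le (H := ⨅ u : s, Subgroup.centralizer {(u : G)}) fun g hg => ?_
    rw [← Subgroup.centralizer_univ, ← Subgroup.coe_top, ← hcl, Subgroup.centralizer_closure,
      Subgroup.mem_centralizer_iff]
    intro u hu
    exact Subgroup.mem_centralizer_iff.1 ((Subgroup.mem_iInf.1 hg) ⟨u, hu⟩) u rfl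
  have : Finite (commutatorSet G) := finite_commutatorSet_of_finiteIndex_center
  have : Group.FG (Abelianization G) := QuotientGroup.fg _
  have htop : CommGroup.torsion (Abelianization G) = ⊤ := by
    rw [eq_top_iff, ← (Abelianization.of (G := G)).range_eq_top.2
      (QuotientGroup.mk_surjective), MonoidHom.range_eq_map, ← hcl, Subgroup.map_le_iff_le_comap,
      Subgroup.closure_le]
    intro u hu
    exact Abelianization.of.isOfFinOrder (hord u hu)
  have : Finite (Abelianization G) := CommGroup.finite_of_fg_isMulTorsion _ fun g => by
    have hg : g ∈ CommGroup.torsion (Abelianization G) := htop ▸ Subgroup.mem_top g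
    exact hg
  have : Finite (G ⧸ commutator G) := this
  exact Finite.of_subgroup_quotient (commutator G)

/-- A form of Dietzmann's lemma: finitely many elements of finite order, each with finitely many
conjugates, generate a finite group. -/
theorem finite_closure_of_isOfFinOrder {G : Type*} [Group G] {s : Set G}
    (hs : s.Finite) (hord : ∀ u ∈ s, IsOfFinOrder u)
    (hfc : ∀ u ∈ s, (Subgroup.centralizer {u}).FiniteIndex) : Finite (Subgroup.closure s) := by
  refine finite_of_closure_eq_top_of_isOfFinOrder
    (hs.preimage (Subtype.val_injective.injOn (s := (Subtype.val : Subgroup.closure s → G) ⁻¹' s)))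
    (Subgroup.closure_closure_coe_preimage (k := s)) ?_ ?_
  · intro u hu
    exact (Subgroup.subtype_injective _).isOfFinOrder_iff.1 (hord u hu)
  · intro u hu
    have := hfc u hu
    refine Subgroup.finiteIndex_of_le
      (H := (Subgroup.centralizer {(u : G)}).subgroupOf (Subgroup.closure s)) fun g hg => ?_
    rw [Subgroup.mem_centralizer_singleton_iff]
    exact Subtype.ext (Subgroup.mem_centralizer_singleton_iff.1 hg)

/-! ### Local finiteness of the algebraic elements -/

theorem exists_isIdempotentElem_pow_of_finite {M : Type*} [Monoid M] {x : M}
    (hx : (Set.range fun n : ℕ => x ^ n).Finite) :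
    ∃ n, 0 < n ∧ IsIdempotentElem (x ^ n) := by
  have := hx.to_subtype
  obtain ⟨a, b, hab, h⟩ := Finite.exists_ne_map_eq_of_infinite (Set.rangeFactorization fun n : ℕ => x ^ n)
  wlog hlt : a < b generalizing a b
  · exact this b a hab.symm h.symm (by omega)
  have h : x ^ a = x ^ b := congrArg Subtype.val h
  obtain ⟨p, rfl⟩ := Nat.exists_eq_add_of_lt hlt
  have hper (k m : ℕ) (hm : a ≤ m) : x ^ (m + k * (p + 1)) = x ^ m := by
    induction k with
    | zero => simp
    | succ k ih =>
      obtain ⟨c, rfl⟩ := Nat.exists_eq_add_of_le hm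
      rw [← ih, show a + c + (k + 1) * (p + 1) = a + p + 1 + (c + k * (p + 1)) by ring,
        show a + c + k * (p + 1) = a + (c + k * (p + 1)) by ring, pow_add, ← h, ← pow_add]
  refine ⟨(a + 1) * (p + 1), by positivity, ?_⟩
  rw [IsIdempotentElem, ← pow_add]
  exact hper _ _ (by nlinarith [Nat.zero_le (a * p)])

/-- If nilpotent elements are central, then so are idempotents: `e * y * (1 - e)` and
`(1 - e) * y * e` have square zero, and commuting with `e` forces them to vanish. -/
theorem commute_of_isIdempotentElem {T : Type*} [Ring T]
    (hnil : ∀ x y : T, IsNilpotent x → Commute x y) {e : T} (he : IsIdempotentElem e) (y : T) :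
    Commute e y := by
  have he' : e * (1 - e) = 0 := he.mul_one_sub_self
  have he'' : (1 - e) * e = 0 := he.one_sub_mul_self
  have h1 : e * y * (1 - e) = 0 := by
    have hc : Commute (e * y * (1 - e)) e := hnil _ _ ⟨2, by
      rw [sq, mul_assoc, ← mul_assoc (1 - e), ← mul_assoc (1 - e), he'']; simp⟩
    have := hc.eq
    rw [mul_assoc _ _ e, he'', mul_zero, ← mul_assoc, ← mul_assoc, he.eq] at this
    exact this.symm
  have h2 : (1 - e) * y * e = 0 := by
    have hc : Commute ((1 - e) * y * e) e := hnil _ _ ⟨2, by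
      rw [sq, mul_assoc, ← mul_assoc e, ← mul_assoc e, he']; simp⟩
    have := hc.eq
    rw [mul_assoc _ e e, he.eq, ← mul_assoc, ← mul_assoc, he', zero_mul, zero_mul] at this
    exact this
  rw [mul_sub, mul_one, sub_eq_zero] at h1
  rw [sub_mul, sub_mul, one_mul, sub_eq_zero] at h2
  exact h1.trans h2.symm

/-- Each algebraic element is the sum of a unit of finite order and a central algebraic element.
Over a finite field some power `e = x ^ n` is idempotent and the unit is `x * e + (1 - e)`; over an
infinite field `x` is itself central and the unit is `1`. -/
theorem exists_unit_isOfFinOrder_add {F T : Type*} [Field F] [Ring T] [Algebra F T]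
    (hfc : ∀ y : T, IsFCElement y) (hnil : ∀ x y : T, IsNilpotent x → Commute x y) {x : T}
    (hx : IsAlgebraic F x) :
    ∃ (u : Tˣ) (z : T), IsOfFinOrder u ∧ IsAlgebraic F z ∧ (∀ y, Commute z y) ∧ x = u + z := by
  have hfg : (Subalgebra.toSubmodule (Algebra.adjoin F {x})).FG := hx.isIntegral.fg_adjoin_singleton
  have hfin : FiniteDimensional F (Algebra.adjoin F {x}) := Module.Finite.iff_fg.2 hfg
  have halg {z : T} (hz : z ∈ Algebra.adjoin F {x}) : IsAlgebraic F z :=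
    (isAlgebraic_algHom_iff (Algebra.adjoin F {x}).val Subtype.val_injective).2
      (Algebra.IsAlgebraic.isAlgebraic (R := F) (⟨z, hz⟩ : Algebra.adjoin F {x}))
  have hxmem : x ∈ Algebra.adjoin F {x} := Algebra.self_mem_adjoin_singleton F x
  rcases finite_or_infinite F with hF | hF
  · have : Finite (Algebra.adjoin F {x}) := Module.finite_of_finite F
    obtain ⟨n, hn, he⟩ := exists_isIdempotentElem_pow_of_finite (x := x)
      ((Set.toFinite (Algebra.adjoin F {x} : Set T)).subset (by
        rintro _ ⟨n, rfl⟩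
        exact pow_mem hxmem n))
    set e := x ^ n with hedef
    have hex : Commute e x := (Commute.refl x).pow_left n
    have hee : e * (1 - e) = 0 := he.mul_one_sub_self
    have hee' : (1 - e) * e = 0 := he.one_sub_mul_self
    have hemem : e ∈ Algebra.adjoin F {x} := pow_mem hxmem n
    -- `x * e + (1 - e)` has `n`-th power `e + (1 - e) = 1`
    have hpow (k : ℕ) (hk : k ≠ 0) : (x * e + (1 - e)) ^ k = x ^ k * e + (1 - e) := by
      induction k with
      | zero => exact absurd rfl hk
      | succ k ih =>
        rcases eq_or_ne k 0 with rfl | hk0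
        · simp
        · have h1 : x ^ k * e * (x * e) = x ^ (k + 1) * e := by
            rw [mul_assoc, ← mul_assoc e, hex.eq, mul_assoc, he.eq, ← mul_assoc, pow_succ]
          have h2 : x ^ k * e * (1 - e) = 0 := by rw [mul_assoc, hee, mul_zero]
          have h3 : (1 - e) * (x * e) = 0 := by rw [← hex.eq, ← mul_assoc, hee', zero_mul]
          rw [pow_succ, ih hk0, mul_add, add_mul, add_mul, h1, h2, h3, he.one_sub.eq]
          abel
    have hpow1 : (x * e + (1 - e)) ^ n = 1 := by
      rw [hpow n hn.ne', ← hedef, he.eq]; abel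
    have hcen : IsNilpotent (x * (1 - e)) := ⟨n, by
      rw [((Commute.one_right x).sub_right hex.symm).mul_pow, ← hedef, he.one_sub.pow_eq hn.ne', hee]⟩
    refine ⟨Units.ofPowEqOne _ n hpow1 hn.ne', x * (1 - e) - (1 - e), ?_, ?_, fun y => ?_, ?_⟩
    · exact isOfFinOrder_iff_pow_eq_one.2 ⟨n, hn, Units.pow_ofPowEqOne _ _⟩
    · exact halg (sub_mem (mul_mem hxmem (sub_mem (one_mem _) hemem)) (sub_mem (one_mem _) hemem))
    · exact (hnil _ y hcen).sub_left
        ((Commute.one_left y).sub_left (commute_of_isIdempotentElem hnil he y))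
    · rw [Units.val_ofPowEqOne]; noncomm_ring
  · refine ⟨1, x - 1, IsOfFinOrder.one, halg (sub_mem hxmem (one_mem _)), fun y => ?_, by simp⟩
    exact (commute_of_isAlgebraic_of_isFCElement hx (hfc y)).sub_left (Commute.one_left y)

theorem finite_closure_units_of_isOfFinOrder {T : Type*} [Ring T]
    (hfc : ∀ y : T, IsFCElement y) {s : Set Tˣ} (hs : s.Finite) (hord : ∀ u ∈ s, IsOfFinOrder u) :
    Finite (Subgroup.closure s) := by
  refine finite_closure_of_isOfFinOrder hs hord fun u _ => ?_
  have : (unitCentralizer (u : T)).FiniteIndex := hfc u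
  refine Subgroup.finiteIndex_of_le (H := unitCentralizer (u : T)) fun g hg => ?_
  rw [Subgroup.mem_centralizer_singleton_iff]
  exact Units.ext (show (g : T) * u = u * g from hg)

theorem Algebra.adjoin_toSubmodule_le_of_mul_mem {F T : Type*} [CommSemiring F] [Semiring T]
    [Algebra F T] {s : Set T} {M : Submodule F T} (h1 : 1 ∈ M)
    (hmul : ∀ x ∈ s, ∀ m ∈ M, x * m ∈ M) :
    Subalgebra.toSubmodule (Algebra.adjoin F s) ≤ M := by
  intro a ha
  have : ∀ m ∈ M, a * m ∈ M := by
    refine Algebra.adjoin_induction (fun x hx => hmul x hx) (fun r m hm => ?_)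
      (fun a b _ _ ha hb m hm => ?_) (fun a b _ _ ha hb m hm => ?_) ha
    · rw [← Algebra.smul_def]; exact M.smul_mem r hm
    · rw [add_mul]; exact M.add_mem (ha m hm) (hb m hm)
    · rw [mul_assoc]; exact ha _ (hb m hm)
  simpa using this 1 h1

theorem fg_adjoin_of_finite_of_isAlgebraic_of_central {F T : Type*} [Field F] [Ring T] [Algebra F T]
    {s : Set T} (hs : s.Finite) (hc : ∀ z ∈ s, ∀ y, Commute z y) (halg : ∀ z ∈ s, IsAlgebraic F z) :
    (Subalgebra.toSubmodule (Algebra.adjoin F s)).FG := by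
  let C := Subalgebra.center F T
  have hCs : C.val '' (Subtype.val ⁻¹' s) = s := by
    refine (Subtype.image_preimage_coe _ _).trans (Set.inter_eq_right.2 fun z hz => ?_)
    exact Subalgebra.mem_center_iff.2 fun y => ((hc z hz y).eq).symm
  have h := fg_adjoin_of_finite (R := F) (s := (Subtype.val ⁻¹' s : Set C))
    (hs.preimage Subtype.val_injective.injOn) fun z hz =>
      ((isAlgebraic_algHom_iff C.val Subtype.val_injective).1 (halg z hz)).isIntegral
  rw [← hCs, ← AlgHom.map_adjoin]
  exact h.map C.val.toLinearMap

/-- The span of the finite group generated by the torsion unit parts, multiplied by the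
finite-dimensional commutative algebra generated by the central parts, contains `1` and is stable
under left multiplication by `s`. -/
theorem finiteDimensional_adjoin_of_isAlgebraic {F T : Type*} [Field F] [Ring T] [Algebra F T]
    (hfc : ∀ y : T, IsFCElement y) (hnil : ∀ x y : T, IsNilpotent x → Commute x y) {s : Set T}
    (hs : s.Finite) (halg : ∀ x ∈ s, IsAlgebraic F x) :
    FiniteDimensional F (Algebra.adjoin F s) := by
  have : Finite s := hs
  choose u z hu hz hzc hxz using fun x : s => exists_unit_isOfFinOrder_add hfc hnil (halg x x.2)
  have hG : Finite (Subgroup.closure (Set.range u)) :=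
    finite_closure_units_of_isOfFinOrder hfc (Set.finite_range u) (by rintro _ ⟨x, rfl⟩; exact hu x)
  let P : Submodule F T :=
    Submodule.span F ((fun g : Tˣ => (g : T)) '' (Subgroup.closure (Set.range u)))
  let C := Algebra.adjoin F (Set.range z)
  have hPfg : P.FG := Submodule.fg_span ((Set.toFinite _).image _)
  have hCfg : (Subalgebra.toSubmodule C).FG :=
    fg_adjoin_of_finite_of_isAlgebraic_of_central (Set.finite_range z)
      (by rintro _ ⟨x, rfl⟩; exact hzc x) (by rintro _ ⟨x, rfl⟩; exact hz x)
  have hfin : FiniteDimensional F (P * Subalgebra.toSubmodule C : Submodule F T) :=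
    Module.Finite.iff_fg.2 (hPfg.mul hCfg)
  have hle : Subalgebra.toSubmodule (Algebra.adjoin F s) ≤ P * Subalgebra.toSubmodule C := by
    refine Algebra.adjoin_toSubmodule_le_of_mul_mem ?_ fun x hx m hm => ?_
    · rw [← mul_one (1 : T)]
      exact Submodule.mul_mem_mul
        (Submodule.subset_span ⟨1, Subgroup.one_mem _, Units.val_one⟩) (one_mem C)
    · rw [show x = u ⟨x, hx⟩ + z ⟨x, hx⟩ from hxz ⟨x, hx⟩, add_mul]
      refine Submodule.add_mem _ ?_ ?_
      · have hP : ∀ p ∈ P, (u ⟨x, hx⟩ : T) * p ∈ P := fun p hp => by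
          induction hp using Submodule.span_induction with
          | mem p hp =>
            obtain ⟨g, hg, rfl⟩ := hp
            exact Submodule.subset_span
              ⟨_, Subgroup.mul_mem _ (Subgroup.subset_closure ⟨_, rfl⟩) hg, Units.val_mul _ _⟩
          | zero => rw [mul_zero]; exact P.zero_mem
          | add a b _ _ ha hb => rw [mul_add]; exact P.add_mem ha hb
          | smul c a _ ha => rw [mul_smul_comm]; exact P.smul_mem c ha
        induction hm using Submodule.mul_induction_on' with
        | mem_mul_mem p hp c hc =>
          rw [← mul_assoc]; exact Submodule.mul_mem_mul (hP p hp) hc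
        | add a _ b _ ha hb => rw [mul_add]; exact Submodule.add_mem _ ha hb
      · induction hm using Submodule.mul_induction_on' with
        | mem_mul_mem p hp c hc =>
          rw [← mul_assoc, (hzc _ p).eq, mul_assoc]
          exact Submodule.mul_mem_mul hp (C.mul_mem (Algebra.subset_adjoin ⟨_, rfl⟩) hc)
        | add a _ b _ ha hb => rw [mul_add]; exact Submodule.add_mem _ ha hb
  exact Submodule.finiteDimensional_of_le hle

/-! ### The Jacobson radical and commutators -/

theorem mem_jacobson_of_isNilpotent_of_central {S : Type*} [Ring S] {x : S} (hx : IsNilpotent x)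
    (hc : ∀ y, Commute x y) : x ∈ Ring.jacobson S := by
  rw [← Ideal.jacobson_bot, Ideal.mem_jacobson_iff]
  intro y
  obtain ⟨u, hu⟩ := ((hc y).symm.isNilpotent_mul_left hx).isUnit_one_add
  refine ⟨(u⁻¹ : Sˣ), ?_⟩
  have h : ((u⁻¹ : Sˣ) : S) * (1 + y * x) = 1 := by rw [← hu, Units.inv_mul]
  rw [mul_add, mul_one] at h
  rw [Ideal.mem_bot, mul_assoc, add_comm, h, sub_self]

theorem isNilpotent_of_mem_jacobson_of_isAlgebraic {F S : Type*} [Field F] [Ring S] [Algebra F S]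
    {x : S} (hx : x ∈ Ring.jacobson S) (halg : IsAlgebraic F x) : IsNilpotent x := by
  obtain ⟨p, hp0, hp⟩ := halg
  obtain ⟨q, hq, hqX⟩ := Polynomial.exists_eq_pow_rootMultiplicity_mul_and_not_dvd p hp0 0
  rw [Polynomial.C_0, sub_zero] at hq hqX
  set k := Polynomial.rootMultiplicity 0 p
  have hq0 : q.coeff 0 ≠ 0 := fun h => hqX (Polynomial.X_dvd_iff.2 h)
  refine ⟨k, ?_⟩
  rw [hq, map_mul, map_pow, Polynomial.aeval_X] at hp
  -- `q(x)` is `q(0)` plus a multiple of `x`, hence left invertible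
  obtain ⟨y, hy⟩ : ∃ y : S, Polynomial.aeval x q = q.coeff 0 • (1 + y * x) := by
    refine ⟨(q.coeff 0)⁻¹ • Polynomial.aeval x q.divX, ?_⟩
    conv_lhs => rw [← Polynomial.divX_mul_X_add q]
    rw [map_add, map_mul, Polynomial.aeval_X, Polynomial.aeval_C, smul_add, smul_mul_assoc,
      smul_inv_smul₀ hq0, Algebra.algebraMap_eq_smul_one, add_comm]
  have hcomm : Commute (x ^ k) (Polynomial.aeval x q) := by
    have := (Polynomial.commute_X_pow q k).map (Polynomial.aeval (R := F) x)
    simpa using this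
  rw [← Ideal.jacobson_bot, Ideal.mem_jacobson_iff] at hx
  obtain ⟨z, hz⟩ := hx y
  rw [Ideal.mem_bot, sub_eq_zero] at hz
  have h0 : (1 + y * x) * x ^ k = 0 := by
    have h := hcomm.eq.symm.trans hp
    rw [hy, smul_mul_assoc] at h
    exact (smul_eq_zero_iff_right hq0).1 h
  calc x ^ k = (z * y * x + z) * x ^ k := by rw [hz, one_mul]
    _ = z * ((1 + y * x) * x ^ k) := by noncomm_ring
    _ = 0 := by rw [h0, mul_zero]

/-- A finite reduced semisimple ring is commutative: all matrix blocks in its Wedderburn–Artin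
decomposition have size one, and finite division rings are commutative. -/
theorem mul_comm_of_finite_of_isReduced {S : Type*} [Ring S] [Finite S] [IsSemisimpleRing S]
    [IsReduced S] (a b : S) : a * b = b * a := by
  obtain ⟨n, D, d, hD, hd, ⟨e⟩⟩ := IsSemisimpleRing.exists_ringEquiv_pi_matrix_divisionRing S
  have hsub (i : Fin n) : Subsingleton (Fin (d i)) := by
    refine ⟨fun j k => by_contra fun hjk => ?_⟩
    have hsq : (Pi.single i (Matrix.single j k 1) : ∀ i, Matrix (Fin (d i)) (Fin (d i)) (D i)) ^ 2
        = 0 := by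
      rw [sq, ← Pi.single_mul, Matrix.single_mul_single_of_ne _ _ _ _ (Ne.symm hjk), Pi.single_zero]
    have h0 := eq_zero_of_pow_eq_zero (x := e.symm (Pi.single i (Matrix.single j k 1))) (n := 2)
      (by rw [← map_pow, hsq, map_zero])
    rw [map_eq_zero_iff _ e.symm.injective, Pi.single_eq_zero_iff] at h0
    simpa using congrFun (congrFun h0 j) k
  have hcomm (i : Fin n) (x y : D i) : x * y = y * x := by
    have : Finite (D i) := by
      refine Finite.of_surjective (fun s : S => e s i 0 0) fun x => ?_
      refine ⟨e.symm (Pi.single i (Matrix.single 0 0 x)), ?_⟩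
      simp
    exact (littleWedderburn (D i)).mul_comm x y
  apply e.injective
  rw [map_mul, map_mul]
  ext i j k
  have := hsub i
  obtain rfl := Subsingleton.elim j k
  rw [Pi.mul_apply, Pi.mul_apply, Matrix.mul_apply, Matrix.mul_apply, Fintype.sum_subsingleton _ j,
    Fintype.sum_subsingleton _ j, hcomm]

/-- As nilpotent elements are central, they are exactly the elements of the Jacobson radical, so the
quotient by it is finite, reduced and semisimple, hence commutative. -/
theorem isNilpotent_commutator_of_finite {S : Type*} [Ring S] [Finite S]
    (hnil : ∀ x y : S, IsNilpotent x → Commute x y) (a b : S) : IsNilpotent (a * b - b * a) := by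
  have hJ : ∀ x ∈ Ring.jacobson S, IsNilpotent x := by
    intro x hx
    obtain ⟨n, hn⟩ := IsSemiprimaryRing.isNilpotent (R := S)
    refine ⟨n, ?_⟩
    have := Ideal.pow_mem_pow hx n
    rwa [hn] at this
  have : Finite (S ⧸ Ring.jacobson S) := Finite.of_surjective _ Ideal.Quotient.mk_surjective
  have : IsReduced (S ⧸ Ring.jacobson S) := by
    refine ⟨fun q ⟨n, hn⟩ => ?_⟩
    obtain ⟨x, rfl⟩ := Ideal.Quotient.mk_surjective q
    rw [← map_pow, Ideal.Quotient.eq_zero_iff_mem] at hn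
    have hx : IsNilpotent x := by
      obtain ⟨m, hm⟩ := hJ _ hn
      exact ⟨n * m, by rw [pow_mul, hm]⟩
    exact Ideal.Quotient.eq_zero_iff_mem.2
      (mem_jacobson_of_isNilpotent_of_central hx fun y => hnil x y hx)
  apply hJ
  rw [← Ideal.Quotient.eq_zero_iff_mem, map_sub, map_mul, map_mul, sub_eq_zero]
  exact mul_comm_of_finite_of_isReduced _ _

theorem isNilpotent_commutator_of_isAlgebraic {F T : Type*} [Field F] [Ring T] [Algebra F T]
    (hfc : ∀ y : T, IsFCElement y) (hnil : ∀ x y : T, IsNilpotent x → Commute x y) {a b : T}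
    (ha : IsAlgebraic F a) (hb : IsAlgebraic F b) : IsNilpotent (a * b - b * a) := by
  rcases finite_or_infinite F with hF | hF
  · let S := Algebra.adjoin F {a, b}
    have : FiniteDimensional F S := finiteDimensional_adjoin_of_isAlgebraic hfc hnil
      (Set.toFinite _) (by rintro x (rfl | rfl) <;> assumption)
    have : Finite S := Module.finite_of_finite F
    have h := isNilpotent_commutator_of_finite (S := S)
      (fun x y hx => Subtype.ext (hnil x y (hx.map S.val)))
      ⟨a, Algebra.subset_adjoin (by simp)⟩ ⟨b, Algebra.subset_adjoin (by simp)⟩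
    exact h.map S.val
  · rw [(commute_of_isAlgebraic_of_isFCElement ha (hfc b)).eq, sub_self]
    exact IsNilpotent.zero

/-- The generators span a finitely generated nil ideal of the commutative ring that is the center;
such an ideal is nilpotent, and the powers of the non-unital algebra lie in its powers. -/
theorem isNilpotent_nonUnitalAdjoin_of_central {F T : Type*} [Field F] [Ring T] [Algebra F T]
    {s : Set T} (hs : s.Finite) (hc : ∀ x ∈ s, ∀ y, Commute x y) (hnil : ∀ x ∈ s, IsNilpotent x) :
    IsNilpotent (NonUnitalAlgebra.adjoin F s).toSubmodule := by
  let C := Subalgebra.center F T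
  let I : Ideal C := Ideal.span (Subtype.val ⁻¹' s)
  have hfg : I.FG := Submodule.fg_span (hs.preimage Subtype.val_injective.injOn)
  obtain ⟨n, hn⟩ : IsNilpotent I := by
    rw [hfg.isNilpotent_iff_le_nilradical, Ideal.span_le]
    intro x hx
    exact (IsNilpotent.map_iff (f := C.val) Subtype.val_injective).1 (hnil x hx)
  let M (k : ℕ) : Submodule F T := ((I ^ k).restrictScalars F).map C.val.toLinearMap
  have hmul {k l : ℕ} {x y : T} (hx : x ∈ M k) (hy : y ∈ M l) : x * y ∈ M (k + l) := by
    obtain ⟨x, hx, rfl⟩ := hx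
    obtain ⟨y, hy, rfl⟩ := hy
    exact ⟨x * y, (pow_add I k l).symm ▸ Ideal.mul_mem_mul hx hy, map_mul C.val x y⟩
  have hle : (NonUnitalAlgebra.adjoin F s).toSubmodule ≤ M 1 := by
    intro x hx
    induction hx using NonUnitalAlgebra.adjoin_induction with
    | mem x hx =>
      refine ⟨⟨x, Subalgebra.mem_center_iff.2 fun y => (hc x hx y).eq.symm⟩, ?_, rfl⟩
      rw [pow_one]
      exact Ideal.subset_span hx
    | zero => exact zero_mem _
    | add x y _ _ hx hy => exact add_mem hx hy
    | smul c x _ hx => exact Submodule.smul_mem _ c hx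
    | mul x y _ _ hx hy =>
      obtain ⟨z, hz, hzxy⟩ := hmul hx hy
      exact ⟨z, Ideal.pow_le_pow_right one_le_two hz, hzxy⟩
  have hpow (k : ℕ) : (NonUnitalAlgebra.adjoin F s).toSubmodule ^ (k + 1) ≤ M (k + 1) := by
    induction k with
    | zero => rwa [zero_add, pow_one]
    | succ k ih =>
      rw [pow_succ, Submodule.mul_le]
      exact fun x hx y hy => hmul (ih hx) (hle hy)
  refine ⟨n + 1, le_bot_iff.1 ((hpow n).trans ?_)⟩
  rintro _ ⟨x, hx, rfl⟩
  have : x ∈ I ^ (n + 1) := hx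
  rw [pow_succ, hn, zero_mul] at this
  rw [show x = 0 from this, map_zero]
  exact zero_mem _

/-! ### The algebraic subalgebra and its radical -/

/-- The subalgebra of all elements algebraic over `F`, for an algebra in which finitely many
algebraic elements always generate a finite-dimensional subalgebra. -/
def algebraicSubalgebra {F T : Type*} [Field F] [Ring T] [Algebra F T]
    (hfin : ∀ s : Set T, s.Finite → (∀ x ∈ s, IsAlgebraic F x) →
      FiniteDimensional F (Algebra.adjoin F s)) : Subalgebra F T where
  carrier := {x | IsAlgebraic F x}
  mul_mem' {a b} ha hb := by
    have := hfin {a, b} (Set.toFinite _) (by rintro x (rfl | rfl) <;> assumption)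
    exact ((Algebra.IsAlgebraic.isAlgebraic (R := F)
      (⟨a, Algebra.subset_adjoin (by simp)⟩ * ⟨b, Algebra.subset_adjoin (by simp)⟩ :
        Algebra.adjoin F {a, b})).algHom (Algebra.adjoin F {a, b}).val :)
  add_mem' {a b} ha hb := by
    have := hfin {a, b} (Set.toFinite _) (by rintro x (rfl | rfl) <;> assumption)
    exact ((Algebra.IsAlgebraic.isAlgebraic (R := F)
      (⟨a, Algebra.subset_adjoin (by simp)⟩ + ⟨b, Algebra.subset_adjoin (by simp)⟩ :
        Algebra.adjoin F {a, b})).algHom (Algebra.adjoin F {a, b}).val :)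
  algebraMap_mem' := isAlgebraic_algebraMap

/-- The two-sided ideal of all nilpotent elements, for a ring whose nilpotent elements are
central. -/
def centralNilpotentIdeal {T : Type*} [Ring T]
    (hnil : ∀ x y : T, IsNilpotent x → Commute x y) : TwoSidedIdeal T :=
  .mk' {x | IsNilpotent x} .zero (fun {x y} hx hy => (hnil x y hx).isNilpotent_add hx hy)
    (fun hx => hx.neg) (fun {x y} hy => (hnil y x hy).symm.isNilpotent_mul_left hy)
    (fun {x y} hx => (hnil x y hx).isNilpotent_mul_right hx)

/-- Elements of the FC-subalgebra are FC-elements also with respect to the unit group of the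
FC-subalgebra itself. -/
theorem isFCElement_of_mem_FCSubalgebra {F R : Type*} [Field F] [Ring R] [Algebra F R]
    (y : FCSubalgebra F R) : IsFCElement y := by
  have : (unitCentralizer (y : R)).FiniteIndex := y.2
  have : ((unitCentralizer (y : R)).comap
      (Units.map (FCSubalgebra F R).val.toMonoidHom)).FiniteIndex := ⟨by
    rw [Subgroup.index_comap]
    exact Subgroup.FiniteIndex.index_ne_zero⟩
  refine Subgroup.finiteIndex_of_le (H := (unitCentralizer (y : R)).comap
    (Units.map (FCSubalgebra F R).val.toMonoidHom)) fun u hu => Subtype.ext hu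

theorem theorem1 {F : Type*} {R : Type*} [Field F] [Ring R] [Algebra F R]
    (hω : ∃ H : Subgroup Rˣ, IsOmegaSubgroup H) :
    ∃ A : Subalgebra F (FCSubalgebra F R),
      (A : Set (FCSubalgebra F R)) = {x | IsAlgebraic F x} ∧
      IsLocallyFiniteAlgebra F A ∧
      (∃ J : TwoSidedIdeal (FCSubalgebra F R),
        (J : Set (FCSubalgebra F R)) = Subtype.val '' (Ring.jacobson A : Set A) ∧
        (∀ x ∈ J, ∀ y : FCSubalgebra F R, x * y = y * x) ∧
        IsLocallyNilpotentIdeal F J) ∧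
      (∀ a b : A ⧸ Ring.jacobson A, a * b = b * a) := by
  obtain ⟨H, hH⟩ := hω
  have hfc : ∀ y : FCSubalgebra F R, IsFCElement y := isFCElement_of_mem_FCSubalgebra
  have hnil : ∀ x y : FCSubalgebra F R, IsNilpotent x → Commute x y := fun x y hx =>
    Subtype.ext (commute_of_isNilpotent_of_isOmegaSubgroup hH x.2 y.2
      (hx.map (FCSubalgebra F R).val))
  let A := algebraicSubalgebra (F := F) fun s : Set (FCSubalgebra F R) =>
    finiteDimensional_adjoin_of_isAlgebraic hfc hnil
  have hAalg (x : A) : IsAlgebraic F x :=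
    (isAlgebraic_algHom_iff A.val Subtype.val_injective).1 x.2
  have hJ (x : A) : x ∈ Ring.jacobson A ↔ IsNilpotent (x : FCSubalgebra F R) := by
    rw [show (x : FCSubalgebra F R) = A.val x from rfl,
      IsNilpotent.map_iff (f := A.val) Subtype.val_injective]
    exact ⟨fun hx => isNilpotent_of_mem_jacobson_of_isAlgebraic hx (hAalg x), fun hx =>
      mem_jacobson_of_isNilpotent_of_central hx fun y => Subtype.ext (hnil x y (hx.map A.val))⟩
  have hmem (x : FCSubalgebra F R) : x ∈ centralNilpotentIdeal hnil ↔ IsNilpotent x :=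
    TwoSidedIdeal.mem_mk' ..
  refine ⟨A, rfl, fun s => ?_, ⟨centralNilpotentIdeal hnil, ?_, fun x hx y => ?_, fun s hs => ?_⟩,
    fun a b => ?_⟩
  · have h := finiteDimensional_adjoin_of_isAlgebraic (F := F) hfc hnil
      (s := A.val '' (s : Set A)) (s.finite_toSet.image _) (by rintro _ ⟨x, -, rfl⟩; exact x.2)
    rw [← AlgHom.map_adjoin] at h
    exact Module.Finite.of_surjective _ ((Algebra.adjoin F (s : Set A)).equivMapOfInjective A.val
      Subtype.val_injective).symm.toLinearEquiv.surjective
  · ext x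
    constructor
    · intro hx
      have hx := (hmem x).1 hx
      obtain ⟨n, hn⟩ := hx
      have hxA : x ∈ A := show IsAlgebraic F x from
        ⟨Polynomial.X ^ n, pow_ne_zero _ Polynomial.X_ne_zero, by simpa using hn⟩
      exact ⟨⟨x, hxA⟩, (hJ _).2 ⟨n, hn⟩, rfl⟩
    · rintro ⟨x, hx, rfl⟩
      exact (hmem _).2 ((hJ x).1 hx)
  · exact hnil x y ((hmem x).1 hx)
  · exact isNilpotent_nonUnitalAdjoin_of_central s.finite_toSet
      (fun x hx y => hnil x y ((hmem x).1 (hs hx))) fun x hx => (hmem x).1 (hs hx)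
  · obtain ⟨a, rfl⟩ := Ideal.Quotient.mk_surjective a
    obtain ⟨b, rfl⟩ := Ideal.Quotient.mk_surjective b
    refine (Ideal.Quotient.eq (x := a * b) (y := b * a)).2 ((hJ _).2 ?_)
    exact isNilpotent_commutator_of_isAlgebraic hfc hnil a.2 b.2
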